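/- Let $d \ge 2$ be an integer. An axis-parallel box in $\mathbb{R}^d$ is a Cartesian product of $d$ intervals. For a finite set $P$ of points in $\mathbb{R}^d$ and a finite set $B$ of axis-parallel boxes in $\mathbb{R}^d$, let $I(P,B)$ be the number of incidences, that is, of pairs $(p,q) \in P\times B$ with $p\in q$, and let $G(P,B)$ be the bipartite graph on $P \sqcup B$ whose edges are these pairs. Logarithms are natural. (1) For every $\varepsilon > 0$ there is a constant $C = C(d,\varepsilon) > 0$ such that for all integers $n \ge 3$, $m \ge 0$, $k \ge 0$, every set $P$ of $n$ points and every set $B$ of $m$ axis-parallel boxes in $\mathbb{R}^d$ for which $G(P,B)$ does not contain $K_{k,k}$ as a subgraph, $$I(P,B) \le C\left( k n \left(\frac{\log n}{\log\log n}\right)^{d-1} + k m (\log n)^{d-2+\varepsilon}\right).$$ (2) For $m=n$ and constant $k \ge 2$ this yields a tight bound of order $n(\log n/\log\log n)^{d-1}$. More precisely: (a) there is a constant $C' = C'(d) > 0$ such that for all $n \ge 3$ and $k \ge 0$, every set $P$ of $n$ points and every set $B$ of $n$ axis-parallel boxes in $\mathbb{R}^d$ for which $G(P,B)$ does not contain $K_{k,k}$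 satisfy $$I(P,B) \le C' k n (\log n/\log\log n)^{d-1};$$ (b) there is a constant $c = c(d) > 0$ such that for every $n \ge 3$ there are a set $P$ of $n$ points and a set $B$ of $n$ axis-parallel boxes in $\mathbb{R}^d$, each a product of $d$ closed bounded intervals of positive length, such that $G(P,B)$ does not contain $K_{2,2}$ (hence contains no $K_{k,k}$ with $k\ge 2$) and $$I(P,B) \ge c\, n (\log n/\log\log n)^{d-1}.$$ -/

import Mathlib

/-- An axis-parallel box in `ℝ^d`: a Cartesian product of `d` intervals. An interval is an
order-connected subset of `ℝ`, so it may be open, closed, half-open, bounded or unbounded. -/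
def IsBox {d : ℕ} (q : Set (Fin d → ℝ)) : Prop :=
  ∃ I : Fin d → Set ℝ, (∀ i, (I i).OrdConnected) ∧ q = Set.univ.pi I

/-- The bipartite point–object incidence graph on the disjoint union of the point set `P` and the
set of objects `B`: a point is adjacent to an object iff it lies in it. -/
def incidenceGraph {X : Type*} (P : Finset X) (B : Finset (Set X)) :
    SimpleGraph (↥P ⊕ ↥B) where
  Adj u v :=
    (∃ (p : ↥P) (q : ↥B), u = Sum.inl p ∧ v = Sum.inr q ∧ p.1 ∈ q.1) ∨
    (∃ (p : ↥P) (q : ↥B), u = Sum.inr q ∧ v = Sum.inl p ∧ p.1 ∈ q.1)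
  symm := ⟨by
    rintro u v (⟨p, q, h₁, h₂, h⟩ | ⟨p, q, h₁, h₂, h⟩)
    · exact Or.inr ⟨p, q, h₂, h₁, h⟩
    · exact Or.inl ⟨p, q, h₂, h₁, h⟩⟩
  loopless := ⟨by
    rintro u (⟨p, q, h₁, h₂, -⟩ | ⟨p, q, h₁, h₂, -⟩) <;> simp [h₁] at h₂⟩

/-- The number of incidences: pairs `(p, q)` with `p ∈ P`, `q ∈ B` and `p ∈ q`. -/
noncomputable def numIncidences {X : Type*} (P : Finset X) (B : Finset (Set X)) : ℕ :=
  {x : X × Set X | x.1 ∈ P ∧ x.2 ∈ B ∧ x.1 ∈ x.2}.ncard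

/-- The incidence graph does not contain the complete bipartite graph `K_{k,k}` as a
(not necessarily induced) subgraph. -/
def IncidenceFree {X : Type*} (k : ℕ) (P : Finset X) (B : Finset (Set X)) : Prop :=
  (completeBipartiteGraph (Fin k) (Fin k)).Free (incidenceGraph P B)

/-!
Upper bound. Coordinates are replaced by ranks (`exists_rank`, `exists_rank_interval`), so that the
points have natural coordinates below `n` and the boxes are products of half-open intervals; write
`A` and `D` for the coefficients in a bound `A * |P| + D * |B|` on the number of incidences.

Three-sided ranges in the plane have `A, D = O(k)` (`incCount_threeSided_le`): for a point `p`, take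
the `k - 1` points to the right of `p` that follow it in the second coordinate, and the `k - 1` ones
that precede it. Fewer than `k` ranges contain `p` and all the former, or `p` and all the latter,
and every range has at most `2 * k` points that are in neither situation.

For boxes in the plane, a `b`-ary search tree of height `h` on one coordinate is used
(`incCount_grid_two_le`). A box is handled only at the lowest node whose slab contains it, where it
splits into at most `b` three-sided ranges, while a point takes part on all levels. This gives
`A = O(k * h)` and `D = O(k * b)`. Each further coordinate is treated by a `b`-ary tree in which a
box is distributed among the `O(b * h)` maximal nodes whose slabs it spans, which multiplies `A` by
`O(h)` and `D` by `O(b * h)` (`incCount_grid_succ_le`). With `b` a small power of `log n`, the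
height `h` is `O(log n / log log n)`, and the bound follows.

Lower bound. Over a prime field with `b` elements, a polynomial of degree less than `h` is
determined by `h` of its Taylor coefficients at `d` distinct points, if they are the leading ones at
each point (`digitPoly_eq_of_taylor_coeff_eq`). Reading these coefficients as digits gives a net
(`exists_net`): two points whose coordinates agree in altogether `h` leading digits are equal. The
boxes of the construction (`exists_points_boxes`) fix `s j` digits of the `j`-th coordinate with
`∑ j, s j = h - 1`, for `g ^ (d - 1)` shapes `s`. Boxes of the same shape are disjoint, and boxes
of different shapes together fix at least `h` digits, so no two boxes share two points; every point
lies in one box of each shape. If `b` is about `2 * g ^ (d - 1)`, there are at most `n` boxes, and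
`g` may be taken of order `log n / log log n`.
-/

section

open Finset

/-! ### Counting incidences of a relation without large bicliques -/

/-- The number of pairs in `P × B` that are related by `R`. -/
noncomputable def incCount {X ι : Type*} (R : X → ι → Prop) (P : Finset X) (B : Finset ι) : ℕ :=
  open Classical in ((P ×ˢ B).filter fun x => R x.1 x.2).card

/-- `R` restricted to `P × B` contains no complete bipartite graph with `k` vertices of `P` on one
side and `k` vertices of `B` on the other. -/
def BicliqueFree {X ι : Type*} (k : ℕ) (R : X → ι → Prop) (P : Finset X) (B : Finset ι) : Prop :=
  ∀ S ⊆ P, ∀ T ⊆ B, S.card = k → T.card = k → ∃ p ∈ S, ∃ q ∈ T, ¬ R p q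

section Counting

variable {X ι : Type*}

theorem BicliqueFree.mono {k : ℕ} {R R' : X → ι → Prop} {P P' : Finset X} {B B' : Finset ι}
    (h : BicliqueFree k R P B) (hP : P' ⊆ P) (hB : B' ⊆ B)
    (hR : ∀ p ∈ P', ∀ q ∈ B', R' p q → R p q) : BicliqueFree k R' P' B' := by
  intro S hS T hT hSk hTk
  obtain ⟨p, hp, q, hq, hpq⟩ := h S (hS.trans hP) T (hT.trans hB) hSk hTk
  exact ⟨p, hp, q, hq, fun h' => hpq (hR p (hS hp) q (hT hq) h')⟩

open Classical in
theorem incCount_eq_sum_left (R : X → ι → Prop) (P : Finset X) (B : Finset ι) :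
    incCount R P B = ∑ p ∈ P, (B.filter fun q => R p q).card := by
  simp only [incCount, card_filter, sum_product]

open Classical in
theorem incCount_eq_sum_right (R : X → ι → Prop) (P : Finset X) (B : Finset ι) :
    incCount R P B = ∑ q ∈ B, (P.filter fun p => R p q).card := by
  simp only [incCount, card_filter, sum_product_right]

theorem incCount_le_left {R : X → ι → Prop} {P : Finset X} {B : Finset ι} {c : ℕ}
    (h : open Classical in ∀ p ∈ P, (B.filter fun q => R p q).card ≤ c) :
    incCount R P B ≤ c * P.card := by
  rw [incCount_eq_sum_left, mul_comm, ← smul_eq_mul]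
  exact sum_le_card_nsmul _ _ _ h

theorem incCount_le_right {R : X → ι → Prop} {P : Finset X} {B : Finset ι} {c : ℕ}
    (h : open Classical in ∀ q ∈ B, (P.filter fun p => R p q).card ≤ c) :
    incCount R P B ≤ c * B.card := by
  rw [incCount_eq_sum_right, mul_comm, ← smul_eq_mul]
  exact sum_le_card_nsmul _ _ _ h

theorem incCount_le_add {R R₁ R₂ : X → ι → Prop} {P : Finset X} {B : Finset ι}
    (h : ∀ p ∈ P, ∀ q ∈ B, R p q → R₁ p q ∨ R₂ p q) :
    incCount R P B ≤ incCount R₁ P B + incCount R₂ P B := by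
  classical
  unfold incCount
  refine le_trans (card_le_card ?_) (card_union_le _ _)
  intro x hx
  simp only [mem_filter, mem_product, mem_union] at hx ⊢
  rcases h x.1 hx.1.1 x.2 hx.1.2 hx.2 with h' | h' <;> simp [hx.1, h']

theorem sum_card_le_of_card_filter_mem_le {J : Type*} {P : Finset X} {s : Finset J}
    {Pj : J → Finset X} {u : ℕ} (hP : ∀ j ∈ s, Pj j ⊆ P)
    (hu : open Classical in ∀ p ∈ P, (s.filter fun j => p ∈ Pj j).card ≤ u) :
    ∑ j ∈ s, (Pj j).card ≤ u * P.card := by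
  classical
  calc ∑ j ∈ s, (Pj j).card = incCount (fun j p => p ∈ Pj j) s P := by
        rw [incCount_eq_sum_left]
        refine sum_congr rfl fun j hj => congrArg card ?_
        ext p
        simp only [mem_filter]
        exact ⟨fun h => ⟨hP j hj h, h⟩, fun h => h.2⟩
    _ ≤ u * P.card := by
        apply incCount_le_right
        intro p hp
        convert hu p hp

/-- Divide and conquer: if the incidences are covered by subproblems that satisfy a bound linear
in their numbers of points and of objects, and if every point and every object takes part in few
subproblems, then the whole problem satisfies a linear bound. -/
theorem incCount_le_of_cover {J : Type*} {R R' : X → ι → Prop} {P : Finset X} {B : Finset ι}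
    (s : Finset J) (Pj : J → Finset X) (Bj : J → Finset ι) {a c u v : ℕ}
    (hP : ∀ j ∈ s, Pj j ⊆ P) (hB : ∀ j ∈ s, Bj j ⊆ B)
    (hu : open Classical in ∀ p ∈ P, (s.filter fun j => p ∈ Pj j).card ≤ u)
    (hv : open Classical in ∀ q ∈ B, (s.filter fun j => q ∈ Bj j).card ≤ v)
    (hcover : ∀ p ∈ P, ∀ q ∈ B, R p q → ∃ j ∈ s, p ∈ Pj j ∧ q ∈ Bj j ∧ R' p q)
    (hbound : ∀ j ∈ s, incCount R' (Pj j) (Bj j) ≤ a * (Pj j).card + c * (Bj j).card) :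
    incCount R P B ≤ a * u * P.card + c * v * B.card := by
  classical
  have h1 : incCount R P B ≤ ∑ j ∈ s, incCount R' (Pj j) (Bj j) := by
    unfold incCount
    refine le_trans (card_le_card ?_) card_biUnion_le
    intro x hx
    simp only [mem_filter, mem_product, mem_biUnion] at hx ⊢
    obtain ⟨j, hj, h1, h2, h3⟩ := hcover x.1 hx.1.1 x.2 hx.1.2 hx.2
    exact ⟨j, hj, ⟨h1, h2⟩, h3⟩
  calc incCount R P B ≤ ∑ j ∈ s, (a * (Pj j).card + c * (Bj j).card) :=
        h1.trans (sum_le_sum hbound)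
    _ = a * ∑ j ∈ s, (Pj j).card + c * ∑ j ∈ s, (Bj j).card := by
        rw [sum_add_distrib, mul_sum, mul_sum]
    _ ≤ a * (u * P.card) + c * (v * B.card) := by
        gcongr
        · exact sum_card_le_of_card_filter_mem_le hP hu
        · exact sum_card_le_of_card_filter_mem_le hB hv
    _ = a * u * P.card + c * v * B.card := by ring

theorem exists_initial_segment {α : Type*} [LinearOrder α] (f : X → α) (S : Finset X) (j : ℕ)
    (hj : j ≤ S.card) :
    ∃ W ⊆ S, W.card = j ∧ ∀ w ∈ W, ∀ v ∈ S, v ∉ W → f w ≤ f v := by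
  classical
  induction j with
  | zero => exact ⟨∅, by simp, by simp, by simp⟩
  | succ j ih =>
    obtain ⟨W, hWS, hWj, hW⟩ := ih (by omega)
    have hne : (S \ W).Nonempty := by
      rw [← card_pos, card_sdiff_of_subset hWS]; omega
    obtain ⟨a, ha, hamin⟩ := exists_min_image (S \ W) f hne
    rw [mem_sdiff] at ha
    refine ⟨insert a W, insert_subset ha.1 hWS, by rw [card_insert_of_notMem ha.2, hWj], ?_⟩
    intro w hw v hv hvW
    rw [mem_insert, not_or] at hvW
    rcases mem_insert.1 hw with rfl | hw
    · exact hamin v (mem_sdiff.2 ⟨hv, hvW.2⟩)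
    · exact hW w hw v hv hvW.2

/-- Suppose that the objects through `p` meet the set `S` in sets that are closed downwards for
`f`. The objects through `p` that contain at least `k - 1` points of `S` all contain the first
`k - 1` points of `S`, so there are fewer than `k` of them. -/
theorem card_filter_le_of_initial {α : Type*} [LinearOrder α] {k : ℕ} (hk : 1 ≤ k)
    {R : X → ι → Prop} {P : Finset X} {B : Finset ι} (hfree : BicliqueFree k R P B)
    (f : X → α) {S : Finset X} (hS : S ⊆ P) {p : X} (hp : p ∈ P) (hpS : p ∉ S)
    (hlow : ∀ q ∈ B, R p q → ∀ w ∈ S, ∀ v ∈ S, f w ≤ f v → R v q → R w q) :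
    open Classical in
    (B.filter fun q => R p q ∧ k - 1 ≤ (S.filter fun w => R w q).card).card ≤ k - 1 := by
  classical
  by_contra! hcon
  have hk' := Nat.succ_le_of_lt hcon
  rw [Nat.succ_eq_add_one, Nat.sub_add_cancel hk] at hk'
  obtain ⟨T, hT, hTk⟩ := exists_subset_card_eq hk'
  have hTB : T ⊆ B := hT.trans (filter_subset _ _)
  obtain ⟨q₀, hq₀⟩ : T.Nonempty := by rw [← card_pos]; omega
  have hSk : k - 1 ≤ S.card :=
    (mem_filter.1 (hT hq₀)).2.2.trans (card_le_card (filter_subset _ _))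
  obtain ⟨W, hWS, hWk, hW⟩ := exists_initial_segment f S (k - 1) hSk
  obtain ⟨w, hw, q, hq, hwq⟩ := hfree (insert p W) (insert_subset hp (hWS.trans hS)) T hTB
    (by rw [card_insert_of_notMem fun h => hpS (hWS h)]; omega) hTk
  have hq' := (mem_filter.1 (hT hq)).2
  rcases mem_insert.1 hw with rfl | hw
  · exact hwq hq'.1
  · -- as `w` is missed, some point of `S` in `q` lies outside `W`, hence beyond `w`
    obtain ⟨v, hv, hvW⟩ : ∃ v ∈ S.filter fun w => R w q, v ∉ W := by
      by_contra! hsub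
      have h1 : (S.filter fun w => R w q) ⊆ W.erase w := by
        intro v hv
        refine mem_erase.2 ⟨?_, hsub v hv⟩
        rintro rfl
        exact hwq (mem_filter.1 hv).2
      have h2 := card_le_card h1
      rw [card_erase_of_mem hw] at h2
      have : 0 < W.card := card_pos.2 ⟨w, hw⟩
      omega
    rw [mem_filter] at hv
    exact hwq (hlow q (hTB hq) hq'.1 w (hWS hw) v hv.1 (hW w hw v hv.1 hvW) hv.2)

/-- The linear bound for three-sided ranges in the plane: a range contains with two points `p`, `v`
every point that is to the right of `p` and whose second coordinate lies between those of `p`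
and `v`. -/
theorem incCount_threeSided_le {α β : Type*} [LinearOrder α] [LinearOrder β] {k : ℕ} (hk : 1 ≤ k)
    {R : X → ι → Prop} {P : Finset X} {B : Finset ι} (hfree : BicliqueFree k R P B)
    (x : X → α) (y : X → β) (hx : Set.InjOn x P)
    (hR : ∀ q ∈ B, ∀ p ∈ P, ∀ w ∈ P, ∀ v ∈ P, R p q → R v q → x p ≤ x w →
      y w ∈ Set.uIcc (y p) (y v) → R w q) :
    incCount R P B ≤ 2 * k * P.card + 2 * k * B.card := by
  classical
  let U : X → Finset X := fun p => P.filter fun w => x p < x w ∧ y p ≤ y w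
  let D : X → Finset X := fun p => P.filter fun w => x p < x w ∧ y w ≤ y p
  let RU : X → ι → Prop := fun p q => R p q ∧ k - 1 ≤ ((U p).filter fun w => R w q).card
  let RD : X → ι → Prop := fun p q => R p q ∧ k - 1 ≤ ((D p).filter fun w => R w q).card
  let RN : X → ι → Prop := fun p q => R p q ∧ ((U p).filter fun w => R w q).card < k - 1 ∧
    ((D p).filter fun w => R w q).card < k - 1
  have hU : incCount RU P B ≤ (k - 1) * P.card := by
    apply incCount_le_left
    intro p hp
    have := card_filter_le_of_initial hk hfree y (S := U p) (filter_subset _ _) hp (by simp [U])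
      (by
        intro q hq hpq w hw v hv hwv hvq
        simp only [U, mem_filter] at hw hv
        exact hR q hq p hp w hw.1 v hv.1 hpq hvq hw.2.1.le
          (Set.mem_uIcc.2 (Or.inl ⟨hw.2.2, hwv⟩)))
    convert this
  have hD : incCount RD P B ≤ (k - 1) * P.card := by
    apply incCount_le_left
    intro p hp
    have := card_filter_le_of_initial hk hfree (fun w => OrderDual.toDual (y w)) (S := D p)
      (filter_subset _ _) hp (by simp [D])
      (by
        intro q hq hpq w hw v hv hwv hvq
        simp only [D, mem_filter] at hw hv
        exact hR q hq p hp w hw.1 v hv.1 hpq hvq hw.2.1.le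
          (Set.mem_uIcc.2 (Or.inr ⟨hwv, hw.2.2⟩)))
    convert this
  have hN : incCount RN P B ≤ (2 * k) * B.card := by
    apply incCount_le_right
    intro q hq
    have hZ : (P.filter fun p => RN p q).card ≤ 2 * k := by
      rcases (P.filter fun p => RN p q).eq_empty_or_nonempty with h0 | hne
      · simp [h0]
      -- the leftmost of these points has all the others to its right
      obtain ⟨p, hp, hmin⟩ := exists_min_image _ x hne
      obtain ⟨hpP, hpR, hpU, hpD⟩ := mem_filter.1 hp
      have hsub : (P.filter fun p => RN p q) ⊆
          insert p (((U p).filter fun w => R w q) ∪ ((D p).filter fun w => R w q)) := by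
        intro w hw
        obtain ⟨hwP, hwR, -, -⟩ := mem_filter.1 hw
        rcases eq_or_ne w p with rfl | hwp
        · simp
        have hlt : x p < x w := lt_of_le_of_ne (hmin w hw) fun h => hwp (hx hwP hpP h.symm)
        rcases le_total (y p) (y w) with h | h <;> simp [U, D, hwP, hwR, hlt, h]
      have h1 := card_le_card hsub
      have h2 := card_insert_le p (((U p).filter fun w => R w q) ∪ ((D p).filter fun w => R w q))
      have h3 := card_union_le ((U p).filter fun w => R w q) ((D p).filter fun w => R w q)
      omega
    convert hZ
  have hsplit : incCount R P B ≤
      incCount RU P B + (incCount RD P B + incCount RN P B) := by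
    refine (incCount_le_add (R₁ := RU) (R₂ := fun p q => RD p q ∨ RN p q) ?_).trans
      (Nat.add_le_add_left (incCount_le_add fun _ _ _ _ h => h) _)
    intro p _ q _ h
    by_cases h1 : k - 1 ≤ ((U p).filter fun w => R w q).card
    · exact Or.inl ⟨h, h1⟩
    by_cases h2 : k - 1 ≤ ((D p).filter fun w => R w q).card
    · exact Or.inr (Or.inl ⟨h, h2⟩)
    · exact Or.inr (Or.inr ⟨h, not_le.1 h1, not_le.1 h2⟩)
  have : (k - 1) * P.card ≤ k * P.card := Nat.mul_le_mul_right _ (Nat.sub_le _ _)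
  have h2 : 2 * k * P.card = k * P.card + k * P.card := by ring
  omega

end Counting

/-! ### Boxes in a grid -/

section Grid

variable {X ι : Type*}

/-- Incidence of grid points and grid boxes: `r i p` is the `i`-th coordinate of the point `p`, and
`q` is the product of the half-open intervals `[lo i q, hi i q)`. -/
def GridRel {d : ℕ} (r : Fin d → X → ℕ) (lo hi : Fin d → ι → ℕ) (p : X) (q : ι) : Prop :=
  ∀ i, lo i q ≤ r i p ∧ r i p < hi i q

theorem div_pow_eq_of_le {b l h : ℕ} {i j : ℕ} (hij : i ≤ j) (h' : l / b ^ i = h / b ^ i) :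
    l / b ^ j = h / b ^ j := by
  obtain ⟨m, rfl⟩ := Nat.exists_eq_add_of_le hij
  rw [pow_add, ← Nat.div_div_eq_div_mul, h', Nat.div_div_eq_div_mul]

/-- The planar bound. In a `b`-ary tree on the coordinate `1`, a box is split among the children of
the lowest node whose slab contains it; in each of these children it is a three-sided range, and
there are at most `b` of them. -/
theorem incCount_grid_two_le {b h k : ℕ} (hb : 2 ≤ b) (hh : 1 ≤ h) (hk : 1 ≤ k)
    (r : Fin 2 → X → ℕ) (lo hi : Fin 2 → ι → ℕ) (P : Finset X) (B : Finset ι)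
    (hr : ∀ i, Set.InjOn (r i) P) (hrb : ∀ i, ∀ p ∈ P, r i p < b ^ h)
    (hhi : ∀ i, ∀ q ∈ B, hi i q ≤ b ^ h) (hfree : BicliqueFree k (GridRel r lo hi) P B) :
    incCount (GridRel r lo hi) P B ≤ 2 * k * (2 * h) * P.card + 2 * k * b * B.card := by
  classical
  have hb0 : 0 < b := by omega
  let PJ : ℕ × ℕ × Bool → Finset X := fun j => P.filter fun p => r 1 p / b ^ j.1 = j.2.1
  let cond : ι → ℕ × ℕ × Bool → Prop := fun q j =>
    lo 1 q / b ^ (j.1 + 1) = (hi 1 q - 1) / b ^ (j.1 + 1) ∧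
    (lo 1 q / b ^ j.1 ≠ (hi 1 q - 1) / b ^ j.1 ∨ j.1 = 0) ∧
    lo 1 q / b ^ j.1 ≤ j.2.1 ∧ j.2.1 ≤ (hi 1 q - 1) / b ^ j.1 ∧
    (j.2.2 = true ↔ j.2.1 < (hi 1 q - 1) / b ^ j.1)
  let BJ : ℕ × ℕ × Bool → Finset ι := fun j => B.filter fun q => cond q j
  have huniq : ∀ q j j', cond q j → cond q j' → j.1 = j'.1 := by
    have : ∀ q j j', cond q j → cond q j' → ¬ j.1 < j'.1 := by
      intro q j j' hj hj' hlt
      rcases hj'.2.1 with h1 | h1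
      · exact h1 (div_pow_eq_of_le hlt hj.1)
      · omega
    intro q j j' hj hj'
    have h1 := this q j j' hj hj'
    have h2 := this q j' j hj' hj
    omega
  refine incCount_le_of_cover (R' := GridRel r lo hi)
    (range h ×ˢ range (b ^ h) ×ˢ (univ : Finset Bool)) PJ BJ
    (fun _ _ => filter_subset _ _) (fun _ _ => filter_subset _ _) ?_ ?_ ?_ ?_
  · intro p hp
    calc _ ≤ ((range h) ×ˢ (univ : Finset Bool)).card := by
          refine card_le_card_of_injOn (fun j => (j.1, j.2.2)) ?_ ?_
          · intro j hj
            simp only [coe_filter, mem_product, Set.mem_ofPred_eq] at hj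
            simpa using hj.1.1
          · rintro ⟨l, j, e⟩ hj ⟨l', j', e'⟩ hj' heq
            simp only [coe_filter, PJ, mem_filter, Set.mem_ofPred_eq] at hj hj'
            simp only [Prod.mk.injEq] at heq
            obtain ⟨rfl, rfl⟩ := heq
            have := hj.2.2.symm.trans hj'.2.2
            simp [this]
      _ = 2 * h := by simp [mul_comm]
  · intro q hq
    calc _ ≤ (range b).card := by
          refine card_le_card_of_injOn (fun j => j.2.1 % b) ?_ ?_
          · intro j _
            simpa using Nat.mod_lt _ hb0
          · rintro ⟨l, j, e⟩ hj ⟨l', j', e'⟩ hj' heq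
            simp only [coe_filter, BJ, mem_filter, Set.mem_ofPred_eq] at hj hj'
            obtain ⟨-, -, hc⟩ := hj
            obtain ⟨-, -, hc'⟩ := hj'
            obtain rfl : l = l' := huniq q _ _ hc hc'
            obtain ⟨h1, -, h3, h4, h5⟩ := hc
            obtain ⟨-, -, h3', h4', h5'⟩ := hc'
            dsimp only at *
            -- the parent of the node `j` is the lowest node that contains the whole box
            have hdiv : j / b = j' / b := by
              rw [pow_succ, ← Nat.div_div_eq_div_mul, ← Nat.div_div_eq_div_mul] at h1
              have a1 := Nat.div_le_div_right (c := b) h3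
              have a2 := Nat.div_le_div_right (c := b) h4
              have a3 := Nat.div_le_div_right (c := b) h3'
              have a4 := Nat.div_le_div_right (c := b) h4'
              omega
            have hjj : j = j' := by
              rw [← Nat.div_add_mod j b, ← Nat.div_add_mod j' b, hdiv, heq]
            subst hjj
            have : e = e' := by rw [Bool.eq_iff_iff, h5, h5']
            rw [this]
      _ = b := card_range b
  · intro p hp q hq hpq
    have h1 := hpq 1
    have hp1 := hrb 1 p hp
    have hq1 := hhi 1 q hq
    have hex : ∃ l, lo 1 q / b ^ (l + 1) = (hi 1 q - 1) / b ^ (l + 1) := by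
      refine ⟨h - 1, ?_⟩
      rw [Nat.sub_add_cancel hh, Nat.div_eq_of_lt (by omega), Nat.div_eq_of_lt (by omega)]
    set l := Nat.find hex with hl
    have hlspec := Nat.find_spec hex
    have hlh : l < h := by
      have : l ≤ h - 1 := by
        apply Nat.find_min'
        rw [Nat.sub_add_cancel hh, Nat.div_eq_of_lt (by omega), Nat.div_eq_of_lt (by omega)]
      omega
    refine ⟨(l, r 1 p / b ^ l, decide (r 1 p / b ^ l < (hi 1 q - 1) / b ^ l)), ?_, ?_, ?_, hpq⟩
    · simp only [mem_product, mem_range, mem_univ, and_true]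
      exact ⟨hlh, (Nat.div_le_self _ _).trans_lt hp1⟩
    · simp [PJ, hp]
    · simp only [BJ, mem_filter, cond]
      refine ⟨hq, hlspec, ?_, Nat.div_le_div_right h1.1, Nat.div_le_div_right (by omega), by simp⟩
      by_cases hl0 : l = 0
      · exact Or.inr hl0
      · left
        have := Nat.find_min hex (m := l - 1) (by omega)
        rwa [Nat.sub_add_cancel (by omega)] at this
  · rintro ⟨l, j, e⟩ -
    have hPJ : PJ (l, j, e) ⊆ P := filter_subset _ _
    have hfree' := hfree.mono hPJ (filter_subset _ _ : BJ (l, j, e) ⊆ B)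
      (fun _ _ _ _ h => h)
    cases e with
    | true =>
      refine incCount_threeSided_le hk hfree' (r 1) (r 0) ((hr 1).mono (by exact_mod_cast hPJ)) ?_
      intro q hq p hp w hw v hv hpq hvq hx hy
      simp only [BJ, PJ, cond, mem_filter] at hq hw
      have hlt := hq.2.2.2.2.2.1 trivial
      rw [← hw.2] at hlt
      have hlt' : r 1 w < hi 1 q - 1 := by
        by_contra! hcon
        exact absurd (Nat.div_le_div_right (c := b ^ l) hcon) (not_le.2 hlt)
      have p0 := hpq 0
      have v0 := hvq 0
      have p1 := hpq 1
      rw [Set.mem_uIcc] at hy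
      intro i
      fin_cases i <;> simp only [Fin.zero_eta, Fin.mk_one, Fin.isValue] <;> omega
    | false =>
      refine incCount_threeSided_le hk hfree' (fun p => OrderDual.toDual (r 1 p)) (r 0)
        ((hr 1).mono (by exact_mod_cast hPJ)) ?_
      intro q hq p hp w hw v hv hpq hvq hx hy
      simp only [BJ, PJ, cond, mem_filter] at hq hw
      replace hx : r 1 w ≤ r 1 p := hx
      have hge : lo 1 q ≤ r 1 w := by
        obtain ⟨-, h1, h2, h3, h4, h5⟩ := hq
        have h5' : j = (hi 1 q - 1) / b ^ l := by
          simp only [Bool.false_eq_true, false_iff] at h5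
          omega
        by_contra! hcon
        have := Nat.div_le_div_right (c := b ^ l) hcon.le
        rw [hw.2] at this
        rcases h2 with h2 | rfl
        · omega
        · simp only [pow_zero, Nat.div_one] at hw h3
          omega
      have p0 := hpq 0
      have v0 := hvq 0
      have p1 := hpq 1
      rw [Set.mem_uIcc] at hy
      intro i
      fin_cases i <;> simp only [Fin.zero_eta, Fin.mk_one, Fin.isValue] <;> omega

/-- Raising the dimension. In a `b`-ary tree on the coordinate `0`, the maximal nodes whose slab
is contained in that of a box number at most `2 * b` on each level, and inside such a node the
coordinate `0` imposes no condition. -/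
theorem incCount_grid_succ_le {d b h a c : ℕ} (hb : 2 ≤ b)
    (r : Fin (d + 1) → X → ℕ) (lo hi : Fin (d + 1) → ι → ℕ) (P : Finset X) (B : Finset ι)
    (hrb : ∀ p ∈ P, r 0 p < b ^ h) (hhi : ∀ q ∈ B, hi 0 q ≤ b ^ h)
    (ih : ∀ P' ⊆ P, ∀ B' ⊆ B,
      (∀ p ∈ P', ∀ q ∈ B', GridRel (fun i => r i.succ) (fun i => lo i.succ) (fun i => hi i.succ) p q
        → GridRel r lo hi p q) →
      incCount (GridRel (fun i => r i.succ) (fun i => lo i.succ) (fun i => hi i.succ)) P' B' ≤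
        a * P'.card + c * B'.card) :
    incCount (GridRel r lo hi) P B ≤
      a * (h + 1) * P.card + c * ((h + 1) * (2 * b)) * B.card := by
  classical
  have hb0 : 0 < b := by omega
  have hpos : ∀ i, 0 < b ^ i := fun i => Nat.pow_pos hb0
  let inside : ι → ℕ → ℕ → Prop := fun q l j => lo 0 q ≤ j * b ^ l ∧ (j + 1) * b ^ l ≤ hi 0 q
  let PJ : ℕ × ℕ → Finset X := fun j => P.filter fun p => r 0 p / b ^ j.1 = j.2
  let BJ : ℕ × ℕ → Finset ι := fun j => B.filter fun q =>
    inside q j.1 j.2 ∧ ¬ inside q (j.1 + 1) (j.2 / b)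
  refine incCount_le_of_cover
    (R' := GridRel (fun i => r i.succ) (fun i => lo i.succ) (fun i => hi i.succ))
    (range (h + 1) ×ˢ range (b ^ h)) PJ BJ
    (fun _ _ => filter_subset _ _) (fun _ _ => filter_subset _ _) ?_ ?_ ?_ ?_
  · intro p hp
    calc _ ≤ (range (h + 1)).card := by
          refine card_le_card_of_injOn (fun j => j.1) ?_ ?_
          · intro j hj
            simp only [coe_filter, mem_product, Set.mem_ofPred_eq] at hj
            simpa using hj.1.1
          · rintro ⟨l, j⟩ hj ⟨l', j'⟩ hj' heq
            simp only [coe_filter, PJ, mem_filter, Set.mem_ofPred_eq] at hj hj'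
            dsimp only at heq
            subst heq
            have := hj.2.2.symm.trans hj'.2.2
            simp [this]
      _ = h + 1 := card_range _
  · intro q hq
    let F : ℕ × Bool × ℕ → ℕ × ℕ := fun t =>
      (t.1, (bif t.2.1 then lo 0 q / b ^ (t.1 + 1) else hi 0 q / b ^ (t.1 + 1)) * b + t.2.2)
    calc _ ≤ ((range (h + 1) ×ˢ (univ : Finset Bool) ×ˢ range b).image F).card := by
          refine card_le_card ?_
          rintro ⟨l, j⟩ hj
          simp only [BJ, mem_filter, mem_product, mem_range] at hj
          obtain ⟨⟨hl, -⟩, -, ⟨h1, h2⟩, h3⟩ := hj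
          have hjb := Nat.div_add_mod j b
          have hjlt := Nat.mod_lt j hb0
          have e1 : j / b * b ^ (l + 1) ≤ j * b ^ l := by
            rw [pow_succ, mul_comm (b ^ l) b, ← mul_assoc]
            exact Nat.mul_le_mul_right _ (Nat.div_mul_le_self j b)
          have e2 : (j + 1) * b ^ l ≤ (j / b + 1) * b ^ (l + 1) := by
            rw [pow_succ, mul_comm (b ^ l) b, ← mul_assoc]
            refine Nat.mul_le_mul_right _ ?_
            rw [add_mul, one_mul, mul_comm]
            omega
          have e3 : j * b ^ l < (j + 1) * b ^ l := Nat.mul_lt_mul_of_pos_right (by omega) (hpos l)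
          -- the slab of the parent contains an end of the slab of `q` in its interior
          have : j / b = lo 0 q / b ^ (l + 1) ∨ j / b = hi 0 q / b ^ (l + 1) := by
            by_cases h4 : lo 0 q ≤ j / b * b ^ (l + 1)
            · right
              have h5 : hi 0 q < (j / b + 1) * b ^ (l + 1) := by
                by_contra! h5
                exact h3 ⟨h4, h5⟩
              exact (Nat.div_eq_of_lt_le (by omega) h5).symm
            · left
              exact (Nat.div_eq_of_lt_le (by omega) (by omega)).symm
          rw [mem_image]
          rcases this with h4 | h4
          · exact ⟨(l, true, j % b), by simpa [hjlt] using hl, by simp [F, ← h4, mul_comm, hjb]⟩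
          · exact ⟨(l, false, j % b), by simpa [hjlt] using hl, by simp [F, ← h4, mul_comm, hjb]⟩
      _ ≤ (range (h + 1) ×ˢ (univ : Finset Bool) ×ˢ range b).card := card_image_le
      _ = (h + 1) * (2 * b) := by simp
  · intro p hp q hq hpq
    have h0 := hpq 0
    have hp0 := hrb p hp
    have hq0 := hhi q hq
    have hfin : ¬ inside q (h + 1) (r 0 p / b ^ (h + 1)) := by
      rintro ⟨-, h2⟩
      have h3 : b ^ h * 2 ≤ b ^ (h + 1) := by rw [pow_succ]; exact Nat.mul_le_mul_left _ hb
      have h4 : b ^ (h + 1) ≤ (r 0 p / b ^ (h + 1) + 1) * b ^ (h + 1) :=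
        Nat.le_mul_of_pos_left _ (Nat.succ_pos _)
      have := hpos h
      omega
    have hex : ∃ l, ¬ inside q (l + 1) (r 0 p / b ^ (l + 1)) := ⟨h, hfin⟩
    set l := Nat.find hex with hl
    have hspec : ¬ inside q (l + 1) (r 0 p / b ^ (l + 1)) := Nat.find_spec hex
    have hlh : l ≤ h := Nat.find_min' hex hfin
    have hin : inside q l (r 0 p / b ^ l) := by
      by_cases hl0 : l = 0
      · rw [hl0]
        simp only [inside, pow_zero, Nat.div_one, mul_one]
        omega
      · have := Nat.find_min hex (m := l - 1) (by omega)
        rw [Nat.sub_add_cancel (by omega)] at this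
        exact not_not.1 this
    refine ⟨(l, r 0 p / b ^ l), ?_, ?_, ?_, fun i => hpq i.succ⟩
    · simp only [mem_product, mem_range]
      exact ⟨by omega, (Nat.div_le_self _ _).trans_lt hp0⟩
    · simp [PJ, hp]
    · simp only [BJ, mem_filter]
      refine ⟨hq, hin, ?_⟩
      rwa [Nat.div_div_eq_div_mul, ← pow_succ]
  · rintro ⟨l, j⟩ -
    refine ih _ (filter_subset _ _) _ (filter_subset _ _) ?_
    intro p hp q hq h i
    refine Fin.cases ?_ h i
    simp only [BJ, inside, mem_filter] at hp hq
    have h1 := Nat.div_add_mod (r 0 p) (b ^ l)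
    have h2 := Nat.mod_lt (r 0 p) (hpos l)
    rw [hp.2, mul_comm] at h1
    generalize r 0 p % b ^ l = m at h1 h2
    have h3 := hq.2.1
    rw [add_mul, one_mul] at h3
    omega

/-- The bound for boxes in the grid `[0, b ^ h) ^ (d + 2)`, linear in the numbers of points and of
boxes. -/
theorem incCount_grid_le {b h k : ℕ} (hb : 2 ≤ b) (hh : 1 ≤ h) (hk : 1 ≤ k) (d : ℕ)
    (r : Fin (d + 2) → X → ℕ) (lo hi : Fin (d + 2) → ι → ℕ) (P : Finset X) (B : Finset ι)
    (hr : ∀ i, Set.InjOn (r i) P) (hrb : ∀ i, ∀ p ∈ P, r i p < b ^ h)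
    (hhi : ∀ i, ∀ q ∈ B, hi i q ≤ b ^ h) (hfree : BicliqueFree k (GridRel r lo hi) P B) :
    incCount (GridRel r lo hi) P B ≤ 2 * k * (2 * h) * (h + 1) ^ d * P.card +
      2 * k * b * ((h + 1) * (2 * b)) ^ d * B.card := by
  induction d generalizing P B with
  | zero => simpa using incCount_grid_two_le hb hh hk r lo hi P B hr hrb hhi hfree
  | succ d ih =>
    have := incCount_grid_succ_le (a := 2 * k * (2 * h) * (h + 1) ^ d)
      (c := 2 * k * b * ((h + 1) * (2 * b)) ^ d) hb r lo hi P B (hrb 0) (hhi 0) ?_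
    · simpa only [pow_succ, mul_assoc] using this
    · intro P' hP' B' hB' himp
      exact ih _ _ _ P' B' (fun i => (hr i.succ).mono (by exact_mod_cast hP'))
        (fun i p hp => hrb i.succ p (hP' hp)) (fun i q hq => hhi i.succ q (hB' hq))
        (hfree.mono hP' hB' himp)

end Grid

/-! ### Reduction of real boxes to grid boxes -/

section Ranks

variable {X : Type*}

/-- The values of a real function on a finite set can be replaced by ranks, with ties broken
arbitrarily. -/
theorem exists_rank (P : Finset X) (f : X → ℝ) :
    ∃ r : X → ℕ, Set.InjOn r P ∧ (∀ p ∈ P, r p < P.card) ∧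
      ∀ p ∈ P, ∀ q ∈ P, r p ≤ r q → f p ≤ f q := by
  classical
  induction P using Finset.induction_on_max_value f with
  | empty => exact ⟨fun _ => 0, by simp, by simp, by simp⟩
  | insert a s ha hmax ih =>
    obtain ⟨r, hinj, hlt, hmono⟩ := ih
    have hup : ∀ p ∈ s, Function.update r a s.card p = r p := fun p hp =>
      Function.update_of_ne (by rintro rfl; exact ha hp) _ _
    have hua : Function.update r a s.card a = s.card := Function.update_self _ _ _
    refine ⟨Function.update r a s.card, ?_, ?_, ?_⟩
    · intro p hp q hq h
      rw [mem_coe, mem_insert] at hp hq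
      rcases hp with rfl | hp <;> rcases hq with rfl | hq
      · rfl
      · rw [hua, hup q hq] at h
        exact absurd (hlt q hq) (by omega)
      · rw [hua, hup p hp] at h
        exact absurd (hlt p hp) (by omega)
      · rw [hup p hp, hup q hq] at h
        exact hinj hp hq h
    · intro p hp
      rw [card_insert_of_notMem ha]
      rcases mem_insert.1 hp with rfl | hp
      · rw [hua]; omega
      · rw [hup p hp]
        have := hlt p hp
        omega
    · intro p hp q hq h
      rw [mem_insert] at hp hq
      rcases hp with rfl | hp <;> rcases hq with rfl | hq
      · rfl
      · rw [hua, hup q hq] at h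
        exact absurd (hlt q hq) (by omega)
      · exact hmax p hp
      · rw [hup p hp, hup q hq] at h
        exact hmono p hp q hq h

theorem exists_rank_interval {P : Finset X} {f : X → ℝ} {r : X → ℕ}
    (hlt : ∀ p ∈ P, r p < P.card) (hmono : ∀ p ∈ P, ∀ q ∈ P, r p ≤ r q → f p ≤ f q)
    {I : Set ℝ} (hI : I.OrdConnected) :
    ∃ l u : ℕ, u ≤ P.card ∧ ∀ p ∈ P, f p ∈ I ↔ l ≤ r p ∧ r p < u := by
  classical
  rcases (P.filter fun p => f p ∈ I).eq_empty_or_nonempty with h0 | hne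
  · refine ⟨0, 0, Nat.zero_le _, fun p hp => ?_⟩
    have : p ∉ P.filter fun p => f p ∈ I := by rw [h0]; simp
    rw [mem_filter, not_and] at this
    simp [this hp]
  · obtain ⟨a, ha, hamin⟩ := exists_min_image _ r hne
    obtain ⟨z, hz, hzmax⟩ := exists_max_image _ r hne
    rw [mem_filter] at ha hz
    refine ⟨r a, r z + 1, hlt z hz.1, fun p hp => ⟨fun h => ?_, fun h => ?_⟩⟩
    · have := hamin p (mem_filter.2 ⟨hp, h⟩)
      have := hzmax p (mem_filter.2 ⟨hp, h⟩)
      omega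
    · exact hI.out ha.2 hz.2 ⟨hmono a ha.1 p hp h.1, hmono p hp z hz.1 (by omega)⟩

end Ranks

theorem numIncidences_eq_incCount {X : Type*} (P : Finset X) (B : Finset (Set X)) :
    numIncidences P B = incCount (fun p (q : Set X) => p ∈ q) P B := by
  classical
  rw [numIncidences, incCount, ← Set.ncard_coe_finset]
  congr 1
  ext x
  simp [and_assoc]

theorem IncidenceFree.bicliqueFree {X : Type*} {k : ℕ} {P : Finset X} {B : Finset (Set X)}
    (h : IncidenceFree k P B) : BicliqueFree k (fun p (q : Set X) => p ∈ q) P B := by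
  intro S hS T hT hSk hTk
  by_contra! hcon
  let eS := S.equivFinOfCardEq hSk
  let eT := T.equivFinOfCardEq hTk
  let g : Fin k ⊕ Fin k → ↥P ⊕ ↥B := Sum.map
    (fun i => ⟨(eS.symm i).1, hS (eS.symm i).2⟩) (fun i => ⟨(eT.symm i).1, hT (eT.symm i).2⟩)
  refine h ⟨⟨⟨g, ?_⟩, ?_⟩⟩
  · rintro (i | i) (j | j) hij
    · simp [completeBipartiteGraph] at hij
    · exact Or.inl ⟨_, _, rfl, rfl, hcon _ (eS.symm i).2 _ (eT.symm j).2⟩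
    · exact Or.inr ⟨_, _, rfl, rfl, hcon _ (eS.symm j).2 _ (eT.symm i).2⟩
    · simp [completeBipartiteGraph] at hij
  · change Function.Injective g
    refine Function.Injective.sumMap ?_ ?_
    · intro i j hij
      exact eS.symm.injective (Subtype.ext (by simpa using hij))
    · intro i j hij
      exact eT.symm.injective (Subtype.ext (by simpa using hij))

theorem one_le_of_incidenceFree {X : Type*} {k : ℕ} {P : Finset X} {B : Finset (Set X)}
    (h : IncidenceFree k P B) : 1 ≤ k := by
  by_contra hk
  obtain rfl : k = 0 := by omega
  obtain ⟨p, hp, -⟩ := h.bicliqueFree ∅ (empty_subset _) ∅ (empty_subset _) rfl rfl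
  simp at hp

theorem numIncidences_boxes_le {b h k d : ℕ} (hb : 2 ≤ b) (hh : 1 ≤ h)
    (P : Finset (Fin (d + 2) → ℝ)) (B : Finset (Set (Fin (d + 2) → ℝ))) (hP : P.card ≤ b ^ h)
    (hB : ∀ q ∈ B, IsBox q) (hfree : IncidenceFree k P B) :
    numIncidences P B ≤ 2 * k * (2 * h) * (h + 1) ^ d * P.card +
      2 * k * b * ((h + 1) * (2 * b)) ^ d * B.card := by
  classical
  choose r hinj hlt hmono using fun i : Fin (d + 2) => exists_rank P fun p => p i
  have hbox : ∀ q : Set (Fin (d + 2) → ℝ), ∃ l u : Fin (d + 2) → ℕ, q ∈ B →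
      (∀ i, u i ≤ P.card) ∧ ∀ p ∈ P, p ∈ q ↔ ∀ i, l i ≤ r i p ∧ r i p < u i := by
    intro q
    by_cases hq : q ∈ B
    · obtain ⟨I, hI, rfl⟩ := hB q hq
      choose l u hu hlu using fun i => exists_rank_interval (hlt i) (hmono i) (hI i)
      refine ⟨l, u, fun _ => ⟨hu, fun p hp => ?_⟩⟩
      rw [Set.mem_univ_pi]
      exact forall_congr' fun i => hlu i p hp
    · exact ⟨0, 0, fun h => absurd h hq⟩
  choose lo hi hbox using hbox
  have hrel : ∀ p ∈ P, ∀ q ∈ B, (p ∈ q ↔ GridRel r (fun i q => lo q i) (fun i q => hi q i) p q) :=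
    fun p hp q hq => (hbox q hq).2 p hp
  have hk := one_le_of_incidenceFree hfree
  have hmain := incCount_grid_le hb hh hk d r (fun i q => lo q i) (fun i q => hi q i) P B hinj
    (fun i p hp => (hlt i p hp).trans_le hP) (fun i q hq => ((hbox q hq).1 i).trans hP)
    (hfree.bicliqueFree.mono subset_rfl subset_rfl fun p hp q hq h => (hrel p hp q hq).2 h)
  refine le_trans (le_of_eq ?_) hmain
  rw [numIncidences_eq_incCount]
  unfold incCount
  congr 1
  refine filter_congr fun x hx => ?_
  rw [mem_product] at hx
  exact hrel x.1 hx.1 x.2 hx.2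

/-! ### The upper bounds -/

theorem one_lt_log_three : 1 < Real.log 3 := by
  rw [Real.lt_log_iff_exp_lt (by norm_num)]
  exact Real.exp_one_lt_d9.trans (by norm_num)

theorem log_three_le_log {n : ℕ} (hn : 3 ≤ n) : Real.log 3 ≤ Real.log n :=
  Real.log_le_log (by norm_num) (by exact_mod_cast hn)

theorem one_lt_log_natCast {n : ℕ} (hn : 3 ≤ n) : 1 < Real.log n :=
  one_lt_log_three.trans_le (log_three_le_log hn)

theorem one_le_div_log_self {x : ℝ} (hx : 1 < x) : 1 ≤ x / Real.log x := by
  rw [one_le_div (Real.log_pos hx)]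
  linarith [Real.log_le_sub_one_of_pos (zero_lt_one.trans hx)]

/-- The branching parameter `b` and the height `h` of the search tree: `b` is a small power of
`log n`. -/
theorem exists_branching_height {δ : ℝ} (hδ : 0 < δ) {n : ℕ} (hn : 3 ≤ n) :
    ∃ b h : ℕ, 2 ≤ b ∧ 1 ≤ h ∧ n ≤ b ^ h ∧ (b : ℝ) ≤ 3 * Real.log n ^ δ ∧
      (h : ℝ) + 1 ≤ (1 / δ + 2) * (Real.log n / Real.log (Real.log n)) := by
  set x := Real.log n with hx
  have hx1 : 1 < x := one_lt_log_natCast hn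
  have hx0 : 0 < x := by linarith
  have hlx : 0 < Real.log x := Real.log_pos hx1
  have hxδ : 1 ≤ x ^ δ := Real.one_le_rpow hx1.le hδ.le
  have hceil : x ^ δ ≤ (⌈x ^ δ⌉₊ : ℝ) := Nat.le_ceil _
  have hceil1 : 1 ≤ ⌈x ^ δ⌉₊ := Nat.one_le_ceil_iff.2 (by linarith)
  obtain ⟨b, hb⟩ : ∃ b, b = ⌈x ^ δ⌉₊ + 1 := ⟨_, rfl⟩
  have hbr : (b : ℝ) = (⌈x ^ δ⌉₊ : ℝ) + 1 := by rw [hb]; push_cast; rfl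
  have hb2 : 2 ≤ b := by omega
  have hb2' : (2 : ℝ) ≤ b := by exact_mod_cast hb2
  have hlb : 0 < Real.log b := Real.log_pos (by linarith)
  have hlb' : δ * Real.log x ≤ Real.log b := by
    rw [← Real.log_rpow hx0]
    exact Real.log_le_log (by linarith) (by linarith)
  have hh := Nat.le_ceil (x / Real.log b)
  refine ⟨b, ⌈x / Real.log b⌉₊, hb2, Nat.one_le_ceil_iff.2 (by positivity), ?_, ?_, ?_⟩
  · rw [div_le_iff₀ hlb] at hh
    have h1 : (n : ℝ) ≤ (b : ℝ) ^ ⌈x / Real.log b⌉₊ := by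
      rw [← Real.log_le_log_iff (by positivity) (by positivity), Real.log_pow]
      exact hh
    exact_mod_cast h1
  · have := Nat.ceil_lt_add_one (show 0 ≤ x ^ δ by linarith)
    linarith
  · have h1 := Nat.ceil_lt_add_one (show 0 ≤ x / Real.log b by positivity)
    have h2 : x / Real.log b ≤ 1 / δ * (x / Real.log x) := by
      rw [div_mul_div_comm, one_mul]
      exact div_le_div_of_nonneg_left hx0.le (by positivity) hlb'
    have h3 := one_le_div_log_self hx1
    linarith

theorem numIncidences_le_of_incidenceFree (d : ℕ) {ε : ℝ} (hε : 0 < ε) :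
    ∃ C : ℝ, 0 < C ∧ ∀ (n m k : ℕ), 3 ≤ n →
      ∀ (P : Finset (Fin (d + 2) → ℝ)) (B : Finset (Set (Fin (d + 2) → ℝ))),
        P.card = n → B.card = m → (∀ q ∈ B, IsBox q) → IncidenceFree k P B →
          (numIncidences P B : ℝ) ≤
            C * ((k : ℝ) * (n : ℝ) * (Real.log n / Real.log (Real.log n)) ^ (d + 1)
              + (k : ℝ) * (m : ℝ) * Real.log n ^ ((d : ℝ) + ε)) := by
  set δ : ℝ := ε / (d + 1) with hδdef
  have hδ : 0 < δ := by positivity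
  set K : ℝ := 1 / δ + 2 with hK
  have hK0 : 0 < K := by positivity
  set c₀ : ℝ := Real.log (Real.log 3) with hc₀
  have hc₀pos : 0 < c₀ := Real.log_pos one_lt_log_three
  refine ⟨4 * K ^ (d + 1) + 6 * (6 * K / c₀) ^ d, by positivity, ?_⟩
  intro n m k hn P B hPn hBm hbox hfree
  obtain ⟨b, h, hb, hh, hbh, hbx, hhx⟩ := exists_branching_height hδ hn
  have hmain := numIncidences_boxes_le hb hh P B (hPn.trans_le hbh) hbox hfree
  rw [hPn, hBm] at hmain
  have hx1 : 1 < Real.log n := one_lt_log_natCast hn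
  have hlx : c₀ ≤ Real.log (Real.log n) :=
    Real.log_le_log (by linarith [one_lt_log_three]) (log_three_le_log hn)
  set x := Real.log n with hx
  set y := x / Real.log x with hy
  have hx0 : 0 < x := by linarith
  have hy1 : 1 ≤ y := one_le_div_log_self hx1
  have hyx : y ≤ x / c₀ := div_le_div_of_nonneg_left hx0.le hc₀pos hlx
  rw [← hK] at hhx
  clear_value y x K c₀
  have hmain' : (numIncidences P B : ℝ) ≤ 2 * k * (2 * h) * ((h : ℝ) + 1) ^ d * n +
      2 * k * b * (((h : ℝ) + 1) * (2 * b)) ^ d * m := by exact_mod_cast hmain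
  have hA : 2 * k * (2 * h) * ((h : ℝ) + 1) ^ d * n ≤
      4 * K ^ (d + 1) * ((k : ℝ) * n * y ^ (d + 1)) := by
    calc 2 * k * (2 * h) * ((h : ℝ) + 1) ^ d * n
        = 4 * k * n * (h * ((h : ℝ) + 1) ^ d) := by ring
      _ ≤ 4 * k * n * (K * y * (K * y) ^ d) := by
          gcongr
          linarith
      _ = _ := by ring
  have hD : 2 * k * b * (((h : ℝ) + 1) * (2 * b)) ^ d * m ≤
      6 * (6 * K / c₀) ^ d * ((k : ℝ) * m * x ^ ((d : ℝ) + ε)) := by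
    calc 2 * k * b * (((h : ℝ) + 1) * (2 * b)) ^ d * m
        ≤ 2 * k * (3 * x ^ δ) * ((K * (x / c₀)) * (2 * (3 * x ^ δ))) ^ d * m := by
          gcongr
          exact hhx.trans (by gcongr)
      _ = 6 * (6 * K / c₀) ^ d * ((k : ℝ) * m * (x ^ d * (x ^ δ) ^ (d + 1))) := by
          rw [div_eq_mul_inv, div_eq_mul_inv]; ring
      _ = _ := by
          rw [← Real.rpow_mul_natCast hx0.le, Real.rpow_add hx0, Real.rpow_natCast, hδdef]
          congr 4
          push_cast
          field_simp
  have hn0 : 0 ≤ (k : ℝ) * n * y ^ (d + 1) := by positivity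
  have hm0 : 0 ≤ (k : ℝ) * m * x ^ ((d : ℝ) + ε) := by positivity
  have h1 : 0 ≤ 4 * K ^ (d + 1) := by positivity
  have h2 : 0 ≤ 6 * (6 * K / c₀) ^ d := by positivity
  rw [add_mul, mul_add, mul_add]
  linarith [mul_nonneg h1 hm0, mul_nonneg h2 hn0]

/-- For as many boxes as points, the term for the boxes with `ε = 1 / 2` is dominated by the one for
the points. -/
theorem exists_rpow_le_div_log_pow (d : ℕ) :
    ∃ C : ℝ, 0 < C ∧ ∀ x : ℝ, 1 < x →
      x ^ ((d : ℝ) + 1 / 2) ≤ C * (x / Real.log x) ^ (d + 1) := by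
  refine ⟨(2 * (d + 1)) ^ (d + 1), by positivity, fun x hx => ?_⟩
  have hx0 : 0 < x := by linarith
  have hlx : 0 < Real.log x := Real.log_pos hx
  have hγ : (0 : ℝ) < 1 / (2 * (d + 1)) := by positivity
  have h1 : Real.log x ≤ 2 * (d + 1) * x ^ (1 / (2 * ((d : ℝ) + 1))) := by
    have := Real.log_le_rpow_div hx0.le hγ
    rwa [div_div_eq_mul_div, div_one, mul_comm] at this
  have h2 : Real.log x ^ (d + 1) ≤ (2 * (d + 1)) ^ (d + 1) * x ^ (1 / 2 : ℝ) := by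
    calc Real.log x ^ (d + 1) ≤ (2 * (d + 1) * x ^ (1 / (2 * ((d : ℝ) + 1)))) ^ (d + 1) := by
          gcongr
      _ = _ := by
          rw [mul_pow, ← Real.rpow_mul_natCast hx0.le]
          congr 2
          push_cast
          field_simp
  rw [div_pow, ← mul_div_assoc, le_div_iff₀ (by positivity)]
  calc x ^ ((d : ℝ) + 1 / 2) * Real.log x ^ (d + 1)
      ≤ x ^ ((d : ℝ) + 1 / 2) * ((2 * (d + 1)) ^ (d + 1) * x ^ (1 / 2 : ℝ)) := by gcongr
    _ = (2 * (d + 1)) ^ (d + 1) * (x ^ ((d : ℝ) + 1 / 2) * x ^ (1 / 2 : ℝ)) := by ring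
    _ = _ := by
        rw [← Real.rpow_add hx0, ← Real.rpow_natCast x (d + 1)]
        congr 2
        push_cast
        ring

theorem numIncidences_le_of_card_eq (d : ℕ) :
    ∃ C : ℝ, 0 < C ∧ ∀ (n k : ℕ), 3 ≤ n →
      ∀ (P : Finset (Fin (d + 2) → ℝ)) (B : Finset (Set (Fin (d + 2) → ℝ))),
        P.card = n → B.card = n → (∀ q ∈ B, IsBox q) → IncidenceFree k P B →
          (numIncidences P B : ℝ) ≤
            C * ((k : ℝ) * (n : ℝ) * (Real.log n / Real.log (Real.log n)) ^ (d + 1)) := by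
  obtain ⟨C, hC, hmain⟩ := numIncidences_le_of_incidenceFree d (ε := 1 / 2) (by norm_num)
  obtain ⟨C', hC', hlog⟩ := exists_rpow_le_div_log_pow d
  refine ⟨C * (1 + C'), by positivity, fun n k hn P B hP hB hbox hfree => ?_⟩
  refine (hmain n n k hn P B hP hB hbox hfree).trans ?_
  rw [mul_assoc C]
  refine mul_le_mul_of_nonneg_left ?_ hC.le
  have := mul_le_mul_of_nonneg_left (hlog _ (one_lt_log_natCast hn))
    (show (0 : ℝ) ≤ (k : ℝ) * n by positivity)
  linarith

/-! ### A digital net from polynomials over a prime field -/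

section Net

/-- The number with leading part `c` and the `i` further digits `v 0, …, v (i - 1)` in base `b`. -/
def appendDigits (b c : ℕ) (v : ℕ → ℕ) : ℕ → ℕ
  | 0 => c
  | i + 1 => appendDigits b c v i * b + v i

theorem appendDigits_div_pow {b c : ℕ} {v : ℕ → ℕ} (hv : ∀ t, v t < b) (i m : ℕ) :
    appendDigits b c v (i + m) / b ^ m = appendDigits b c v i := by
  induction m with
  | zero => simp
  | succ m ih =>
    have hb : 0 < b := (Nat.zero_le _).trans_lt (hv 0)
    rw [← add_assoc, appendDigits, pow_succ', ← Nat.div_div_eq_div_mul, mul_comm,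
      Nat.mul_add_div hb, Nat.div_eq_of_lt (hv _), add_zero, ih]

theorem digit_eq_of_appendDigits_eq {b c c' : ℕ} {v v' : ℕ → ℕ} (hv : ∀ t, v t < b)
    (hv' : ∀ t, v' t < b) {i : ℕ} (h : appendDigits b c v i = appendDigits b c' v' i) :
    c = c' ∧ ∀ t < i, v t = v' t := by
  induction i with
  | zero => exact ⟨h, by simp⟩
  | succ i ih =>
    have hb : 0 < b := (Nat.zero_le _).trans_lt (hv 0)
    simp only [appendDigits] at h
    have h1 : appendDigits b c v i = appendDigits b c' v' i := by
      have := congrArg (· / b) h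
      simpa [mul_comm _ b, Nat.mul_add_div hb, Nat.div_eq_of_lt (hv _),
        Nat.div_eq_of_lt (hv' _)] using this
    obtain ⟨hc, hlt⟩ := ih h1
    refine ⟨hc, fun t ht => ?_⟩
    rcases Nat.lt_succ_iff_lt_or_eq.1 ht with ht | rfl
    · exact hlt t ht
    · rw [h1] at h; omega

open Polynomial in
/-- The polynomial whose coefficients are the last `h` digits of `a` in base `b`. -/
noncomputable def digitPoly (b h a : ℕ) : (ZMod b)[X] :=
  ∑ t ∈ range h, C ((a / b ^ t : ℕ) : ZMod b) * X ^ t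

theorem coeff_digitPoly {b h a t : ℕ} (ht : t < h) :
    (digitPoly b h a).coeff t = ((a / b ^ t : ℕ) : ZMod b) := by
  simp [digitPoly, Polynomial.coeff_X_pow, ht]

theorem mod_pow_eq_of_digitPoly_eq {b h a a' : ℕ} (hp : digitPoly b h a = digitPoly b h a') :
    a % b ^ h = a' % b ^ h := by
  have key : ∀ t < h, a / b ^ t % b = a' / b ^ t % b := by
    intro t ht
    have := congrArg (fun f => f.coeff t) hp
    simp only [coeff_digitPoly ht] at this
    exact (ZMod.natCast_eq_natCast_iff' _ _ _).1 this
  have : ∀ i ≤ h, a % b ^ i = a' % b ^ i := by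
    intro i
    induction i with
    | zero => simp [Nat.mod_one]
    | succ i ih =>
      intro hi
      rw [Nat.mod_pow_succ, Nat.mod_pow_succ, ih (by omega), key i (by omega)]
  exact this h le_rfl

open Polynomial in
/-- A polynomial of degree less than `h` is determined by `h` of its Taylor coefficients, if at
each of the expansion points these are the leading ones. -/
theorem digitPoly_eq_of_taylor_coeff_eq {b h d a a' : ℕ} [Fact b.Prime] {α : Fin d → ZMod b}
    (hα : Function.Injective α) (i : Fin d → ℕ) (hi : h ≤ ∑ j, i j)
    (heq : ∀ j, ∀ t < i j, (taylor (α j) (digitPoly b h a)).coeff t =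
      (taylor (α j) (digitPoly b h a')).coeff t) :
    digitPoly b h a = digitPoly b h a' := by
  have hdvd : (∏ j, (X - C (α j)) ^ i j) ∣ digitPoly b h a - digitPoly b h a' := by
    refine Finset.prod_dvd_of_coprime ?_ ?_
    · intro j _ j' _ hjj
      exact (pairwise_coprime_X_sub_C hα hjj).pow
    · intro j _
      rw [X_sub_C_pow_dvd_iff, ← taylor_apply, X_pow_dvd_iff]
      intro t ht
      rw [map_sub, coeff_sub, heq j t ht, sub_self]
  have hdeg : ∀ a, (digitPoly b h a).degree < h := by
    intro a
    rw [degree_lt_iff_coeff_zero]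
    intro m hm
    have : ∀ t ∈ range h, m ≠ t := fun t ht => by rw [mem_range] at ht; omega
    simp only [digitPoly, finsetSum_coeff, coeff_C_mul, coeff_X_pow]
    exact sum_eq_zero fun t ht => by simp [this t ht]
  have hprod : (∏ j, (X - C (α j)) ^ i j).degree = ((∑ j, i j : ℕ) : WithBot ℕ) := by
    rw [degree_prod]
    simp
  refine sub_eq_zero.1 (eq_zero_of_dvd_of_degree_lt hdvd ?_)
  rw [hprod]
  exact ((degree_sub_le _ _).trans_lt (max_lt (hdeg a) (hdeg a'))).trans_le (by exact_mod_cast hi)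

/-- A digital net over a prime field, in the form of a sequence of points with natural coordinates.
The coordinates of a block of `b ^ h` consecutive points have a common leading part and `h` further
digits in base `b`; the digits of the `j`-th coordinate are the Taylor coefficients at `j` of a
polynomial of degree less than `h`. Two points that agree in altogether `h` leading digits of their
coordinates, besides the common leading part, coincide. -/
theorem exists_net {b d h : ℕ} (hb : b.Prime) (hd : 0 < d) (hdb : d ≤ b) :
    ∃ x : Fin d → ℕ → ℕ, (∀ j a, x j a / b ^ h = a / b ^ h) ∧
      ∀ (a a' : ℕ) (i : Fin d → ℕ), (∀ j, i j ≤ h) → h ≤ ∑ j, i j →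
        (∀ j, x j a / b ^ (h - i j) = x j a' / b ^ (h - i j)) → a = a' := by
  have : Fact b.Prime := ⟨hb⟩
  have : NeZero b := ⟨hb.ne_zero⟩
  let α : Fin d → ZMod b := fun j => ((j : ℕ) : ZMod b)
  have hα : Function.Injective α := by
    intro j j' hjj
    have := (ZMod.natCast_eq_natCast_iff' _ _ _).1 hjj
    rw [Nat.mod_eq_of_lt (j.2.trans_le hdb), Nat.mod_eq_of_lt (j'.2.trans_le hdb)] at this
    exact Fin.ext this
  let v : Fin d → ℕ → ℕ → ℕ := fun j a t =>
    ((Polynomial.taylor (α j) (digitPoly b h a)).coeff t).val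
  have hv : ∀ j a t, v j a t < b := fun j a t => ZMod.val_lt _
  have hlead : ∀ j a, ∀ i ≤ h, appendDigits b (a / b ^ h) (v j a) h / b ^ (h - i) =
      appendDigits b (a / b ^ h) (v j a) i := by
    intro j a i hi
    have := appendDigits_div_pow (c := a / b ^ h) (hv j a) i (h - i)
    rwa [Nat.add_sub_cancel' hi] at this
  refine ⟨fun j a => appendDigits b (a / b ^ h) (v j a) h, ?_, ?_⟩
  · intro j a
    exact hlead j a 0 (Nat.zero_le _)
  · intro a a' i hih hi heq
    have hdig : ∀ j, a / b ^ h = a' / b ^ h ∧ ∀ t < i j, v j a t = v j a' t := by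
      intro j
      have := heq j
      rw [hlead j a _ (hih j), hlead j a' _ (hih j)] at this
      exact digit_eq_of_appendDigits_eq (hv j a) (hv j a') this
    have hpoly := digitPoly_eq_of_taylor_coeff_eq hα i hi
      (fun j t ht => ZMod.val_injective b ((hdig j).2 t ht))
    rw [← Nat.div_add_mod a (b ^ h), ← Nat.div_add_mod a' (b ^ h), (hdig ⟨0, hd⟩).1,
      mod_pow_eq_of_digitPoly_eq hpoly]

end Net

/-! ### Elementary boxes of the net -/

theorem incidenceFree_of_two {X : Type*} {P : Finset X} {B : Finset (Set X)}
    (h : ∀ p ∈ P, ∀ p' ∈ P, ∀ q ∈ B, ∀ q' ∈ B, p ∈ q → p' ∈ q → p ∈ q' → p' ∈ q' → p ≠ p' → q = q')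
    {k : ℕ} (hk : 2 ≤ k) : IncidenceFree k P B := by
  rintro ⟨⟨f, hf⟩⟩
  let i₀ : Fin k := ⟨0, by omega⟩
  let i₁ : Fin k := ⟨1, by omega⟩
  have hne : i₀ ≠ i₁ := by simp [i₀, i₁]
  have hadj : ∀ i j : Fin k, (incidenceGraph P B).Adj (f (Sum.inl i)) (f (Sum.inr j)) :=
    fun i j => f.map_rel (by simp [completeBipartiteGraph])
  have hl : f (Sum.inl i₀) ≠ f (Sum.inl i₁) := fun e => hne (Sum.inl_injective (hf e))
  have hr : f (Sum.inr i₀) ≠ f (Sum.inr i₁) := fun e => hne (Sum.inr_injective (hf e))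
  have h00 := hadj i₀ i₀
  have h01 := hadj i₀ i₁
  have h10 := hadj i₁ i₀
  have h11 := hadj i₁ i₁
  generalize f (Sum.inl i₀) = u₀ at *
  generalize f (Sum.inl i₁) = u₁ at *
  generalize f (Sum.inr i₀) = v₀ at *
  generalize f (Sum.inr i₁) = v₁ at *
  rcases u₀ with p₀ | q₀ <;> rcases u₁ with p₁ | q₁ <;> rcases v₀ with p₂ | q₂ <;>
    rcases v₁ with p₃ | q₃ <;> simp [incidenceGraph] at h00 h01 h10 h11 hl hr
  · exact hr (Subtype.ext (h p₀ p₀.2 p₁ p₁.2 q₂ q₂.2 q₃ q₃.2 h00 h10 h01 h11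
      fun e => hl (Subtype.ext e)))
  · exact hl (Subtype.ext (h p₂ p₂.2 p₃ p₃.2 q₀ q₀.2 q₁ q₁.2 h00 h01 h10 h11
      fun e => hr (Subtype.ext e)))

section Boxes

/-- The product of the intervals `[κ j * b ^ e j, (κ j + 1) * b ^ e j - 1 / 2]`: it contains the
points with natural coordinates whose quotients by the `b ^ e j` are the `κ j`, and no others. -/
def keyBox {d : ℕ} (b : ℕ) (e κ : Fin d → ℕ) : Set (Fin d → ℝ) :=
  Set.Icc (fun j => (κ j : ℝ) * (b : ℝ) ^ e j)
    (fun j => (κ j : ℝ) * (b : ℝ) ^ e j + ((b : ℝ) ^ e j - 1 / 2))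

theorem natCast_mem_keyBox {d b : ℕ} (hb : 0 < b) (e κ x : Fin d → ℕ) :
    (fun j => (x j : ℝ)) ∈ keyBox b e κ ↔ ∀ j, x j / b ^ e j = κ j := by
  simp only [keyBox, Set.mem_Icc, Pi.le_def, ← forall_and]
  refine forall_congr' fun j => ?_
  have hpos : 0 < b ^ e j := Nat.pow_pos hb
  have hiff : x j / b ^ e j = κ j ↔ κ j * b ^ e j ≤ x j ∧ x j + 1 ≤ κ j * b ^ e j + b ^ e j := by
    constructor
    · intro h
      have h1 := Nat.div_add_mod (x j) (b ^ e j)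
      have h2 := Nat.mod_lt (x j) hpos
      rw [h, mul_comm] at h1
      generalize x j % b ^ e j = m at h1 h2
      omega
    · rintro ⟨h1, h2⟩
      exact Nat.div_eq_of_lt_le h1 (by rw [add_mul, one_mul]; omega)
  rw [hiff]
  refine and_congr (by exact_mod_cast Iff.rfl) ⟨fun h => ?_, fun h => ?_⟩
  · by_contra! hcon
    have h1 : κ j * b ^ e j + b ^ e j ≤ x j := by omega
    have h2 : (κ j : ℝ) * (b : ℝ) ^ e j + (b : ℝ) ^ e j ≤ x j := by exact_mod_cast h1
    linarith
  · have h2 : (x j : ℝ) + 1 ≤ κ j * (b : ℝ) ^ e j + (b : ℝ) ^ e j := by exact_mod_cast h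
    linarith

theorem pow_sub_half_pos {b : ℕ} (hb : 0 < b) (e : ℕ) : (0 : ℝ) < (b : ℝ) ^ e - 1 / 2 := by
  have : (1 : ℝ) ≤ (b : ℝ) ^ e := one_le_pow₀ (by exact_mod_cast hb)
  linarith

theorem keyBox_exponent_eq {d b : ℕ} (hb : 2 ≤ b) {e e' κ κ' : Fin d → ℕ}
    (h : keyBox b e κ = keyBox b e' κ') : e = e' := by
  have hb0 : 0 < b := by omega
  have hle : (fun j => (κ j : ℝ) * (b : ℝ) ^ e j) ≤
      (fun j => (κ j : ℝ) * (b : ℝ) ^ e j + ((b : ℝ) ^ e j - 1 / 2)) := fun j => by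
    have := pow_sub_half_pos hb0 (e j)
    dsimp only
    linarith
  obtain ⟨h1, h2⟩ := (Set.Icc_eq_Icc_iff hle).1 h
  funext j
  have h1 := congrFun h1 j
  have h2 := congrFun h2 j
  have h3 : (b : ℝ) ^ e j = (b : ℝ) ^ e' j := by linarith
  exact Nat.pow_right_injective hb (by exact_mod_cast h3)

/-- Boxes that contain no point of the non-negative orthant, to fill up a family of boxes to a
prescribed size. -/
theorem exists_boxes_disjoint {d : ℕ} (hd : 0 < d) (B : Finset (Set (Fin d → ℝ))) (m : ℕ) :
    ∃ T : Finset (Set (Fin d → ℝ)), T.card = m ∧ Disjoint T B ∧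
      (∀ q ∈ T, ∃ a b : Fin d → ℝ, (∀ i, a i < b i) ∧ q = Set.Icc a b) ∧
      ∀ q ∈ T, ∀ x ∈ q, ¬ 0 ≤ x := by
  let g : ℕ → Set (Fin d → ℝ) := fun t =>
    Set.Icc (fun _ => -((t : ℝ) + 1)) (fun _ => -((t : ℝ) + 1) + 1 / 2)
  have hg : Function.Injective g := by
    intro t t' h
    have hle : (fun _ : Fin d => -((t : ℝ) + 1)) ≤ (fun _ => -((t : ℝ) + 1) + 1 / 2) := fun j => by
      dsimp only
      linarith
    have := congrFun ((Set.Icc_eq_Icc_iff hle).1 h).1 ⟨0, hd⟩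
    exact_mod_cast (show (t : ℝ) = t' by linarith)
  obtain ⟨T, hT, hTm⟩ :=
    ((Set.infinite_range_of_injective hg).sdiff B.finite_toSet).exists_subset_card_eq m
  refine ⟨T, hTm, ?_, ?_, ?_⟩
  · rw [Finset.disjoint_left]
    exact fun q hq => (hT hq).2
  · intro q hq
    obtain ⟨t, rfl⟩ := (hT hq).1
    exact ⟨_, _, fun i => by linarith, rfl⟩
  · intro q hq x hx hx0
    obtain ⟨t, rfl⟩ := (hT hq).1
    have h1 := hx.2 ⟨0, hd⟩
    have h2 := hx0 ⟨0, hd⟩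
    dsimp at h1 h2
    have : (0 : ℝ) ≤ t := Nat.cast_nonneg t
    linarith

/-- The lower bound construction: the boxes are the elementary boxes of the net of all the shapes in
`S`, each of which fixes `h - 1` digits. Two boxes of distinct shapes together fix at least `h`
digits, so they have at most one point of the net in common. -/
theorem exists_points_boxes {b d h n : ℕ} (hb : b.Prime) (hd : 0 < d) (hdb : d ≤ b)
    (S : Finset (Fin d → ℕ)) (hS : ∀ s ∈ S, ∑ j, s j + 1 = h)
    (hcount : S.card * (b ^ (h - 1) * (n / b ^ h + 1)) ≤ n) :
    ∃ (P : Finset (Fin d → ℝ)) (B : Finset (Set (Fin d → ℝ))),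
      P.card = n ∧ B.card = n ∧
      (∀ q ∈ B, ∃ a b : Fin d → ℝ, (∀ i, a i < b i) ∧ q = Set.Icc a b) ∧
      (∀ k : ℕ, 2 ≤ k → IncidenceFree k P B) ∧
      n * S.card ≤ numIncidences P B := by
  classical
  have hb0 : 0 < b := hb.pos
  obtain ⟨x, hxc, hx⟩ := exists_net (h := h) hb hd hdb
  have hsh : ∀ s ∈ S, ∀ j, s j ≤ h := by
    intro s hs j
    have h1 := hS s hs
    have h2 := Finset.single_le_sum (f := s) (fun i _ => Nat.zero_le _) (mem_univ j)
    omega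
  let pt : ℕ → Fin d → ℝ := fun a j => (x j a : ℝ)
  have hpt : Function.Injective pt := by
    intro a a' haa
    refine hx a a' (fun _ => h) (fun _ => le_rfl) ?_ fun j => ?_
    · simpa using Nat.le_mul_of_pos_left h hd
    · have := congrFun haa j
      simp only [pt, Nat.cast_inj] at this
      rw [this]
  let e : (Fin d → ℕ) → Fin d → ℕ := fun s j => h - s j
  let box : (Fin d → ℕ) → ℕ → Set (Fin d → ℝ) := fun s a =>
    keyBox b (e s) fun j => x j a / b ^ e s j
  have hmem : ∀ a s u, pt a ∈ box s u ↔ ∀ j, x j a / b ^ e s j = x j u / b ^ e s j :=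
    fun a s u => natCast_mem_keyBox hb0 _ _ fun j => x j a
  have hbox_inj : ∀ s ∈ S, ∀ s' ∈ S, ∀ a a', box s a = box s' a' → s = s' := by
    intro s hs s' hs' a a' hss
    funext j
    have h1 := congrFun (keyBox_exponent_eq hb.two_le hss) j
    have h2 := hsh s hs j
    have h3 := hsh s' hs' j
    simp only [e] at h1
    omega
  let B₀ : Finset (Set (Fin d → ℝ)) := S.biUnion fun s => (range n).image (box s)
  have hB₀ : B₀.card ≤ n := by
    refine (card_biUnion_le_card_mul _ _ _ fun s hs => ?_).trans hcount
    -- a box of shape `s` is given by a block and by `s j` digits for each `j`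
    let F : ℕ × (Fin d → ℕ) → Set (Fin d → ℝ) := fun t =>
      keyBox b (e s) fun j => b ^ s j * t.1 + t.2 j
    have hsub : (range n).image (box s) ⊆
        ((range (n / b ^ h + 1)) ×ˢ Fintype.piFinset fun j => range (b ^ s j)).image F := by
      intro q hq
      obtain ⟨a, ha, rfl⟩ := mem_image.1 hq
      refine mem_image.2 ⟨(a / b ^ h, fun j => x j a / b ^ e s j % b ^ s j), ?_, ?_⟩
      · simp only [mem_product, mem_range, Fintype.mem_piFinset] at ha ⊢
        exact ⟨Nat.lt_succ_of_le (Nat.div_le_div_right ha.le),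
          fun j => Nat.mod_lt _ (Nat.pow_pos hb0)⟩
      · simp only [F, box]
        congr 1
        funext j
        have h1 := Nat.div_add_mod (x j a / b ^ e s j) (b ^ s j)
        rwa [Nat.div_div_eq_div_mul, ← pow_add, Nat.sub_add_cancel (hsh s hs j), hxc] at h1
    calc ((range n).image (box s)).card
        ≤ ((range (n / b ^ h + 1)) ×ˢ Fintype.piFinset fun j => range (b ^ s j)).card :=
          (card_le_card hsub).trans card_image_le
      _ = b ^ (h - 1) * (n / b ^ h + 1) := by
          rw [card_product, Fintype.card_piFinset, card_range, mul_comm]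
          simp only [card_range]
          rw [prod_pow_eq_pow_sum, ← hS s hs, Nat.add_sub_cancel]
  obtain ⟨T, hTcard, hTdisj, hTbox, hTneg⟩ := exists_boxes_disjoint hd B₀ (n - B₀.card)
  have hmemB : ∀ a, ∀ q ∈ T ∪ B₀, pt a ∈ q → ∃ s ∈ S, q = box s a := by
    intro a q hq haq
    rcases mem_union.1 hq with hq | hq
    · exact absurd (show 0 ≤ pt a from fun j => Nat.cast_nonneg _) (hTneg q hq _ haq)
    · simp only [B₀, mem_biUnion, mem_image] at hq
      obtain ⟨s, hs, u, -, rfl⟩ := hq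
      refine ⟨s, hs, ?_⟩
      have := (hmem a s u).1 haq
      simp only [box]
      congr 1
      funext j
      exact (this j).symm
  refine ⟨(range n).image pt, T ∪ B₀, ?_, ?_, ?_, ?_, ?_⟩
  · rw [card_image_of_injective _ hpt, card_range]
  · rw [card_union_of_disjoint hTdisj, hTcard]
    omega
  · intro q hq
    rcases mem_union.1 hq with hq | hq
    · exact hTbox q hq
    · simp only [B₀, mem_biUnion, mem_image] at hq
      obtain ⟨s, hs, u, -, rfl⟩ := hq
      exact ⟨_, _, fun j => by have := pow_sub_half_pos hb0 (e s j); linarith, rfl⟩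
  · intro k hk
    refine incidenceFree_of_two ?_ hk
    intro p hp p' hp' q hq q' hq' h1 h2 h3 h4 hne
    obtain ⟨a, -, rfl⟩ := mem_image.1 hp
    obtain ⟨a', -, rfl⟩ := mem_image.1 hp'
    obtain ⟨s, hs, rfl⟩ := hmemB a q hq h1
    obtain ⟨s', hs', rfl⟩ := hmemB a q' hq' h3
    by_contra hqq
    have hss : s ≠ s' := by rintro rfl; exact hqq rfl
    -- the two points agree in `max (s j) (s' j)` leading digits of the `j`-th coordinate
    have h2 := (hmem a' s a).1 h2
    have h4 := (hmem a' s' a).1 h4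
    refine hne (congrArg pt (hx a a' (fun j => max (s j) (s' j))
      (fun j => max_le (hsh s hs j) (hsh s' hs' j)) ?_ fun j => ?_))
    · have h5 := hS s hs
      have h6 := hS s' hs'
      obtain ⟨j, hj⟩ : ∃ j, s j < s' j := by
        by_contra! hle
        refine hss (funext fun j => ?_)
        have := (sum_eq_sum_iff_of_le fun j _ => hle j).1 (show ∑ j, s' j = ∑ j, s j by omega)
        exact (this j (mem_univ j)).symm
      have : ∑ j, s j < ∑ j, max (s j) (s' j) :=
        sum_lt_sum (fun j _ => le_max_left _ _) ⟨j, mem_univ j, lt_max_of_lt_right hj⟩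
      omega
    · rcases max_choice (s j) (s' j) with hm | hm <;> rw [hm]
      · exact (h2 j).symm
      · exact (h4 j).symm
  · rw [numIncidences]
    have hsub : (↑(((range n) ×ˢ S).image fun t => (pt t.1, box t.2 t.1)) :
        Set ((Fin d → ℝ) × Set (Fin d → ℝ))) ⊆
        {y | y.1 ∈ (range n).image pt ∧ y.2 ∈ T ∪ B₀ ∧ y.1 ∈ y.2} := by
      intro y hy
      obtain ⟨⟨a, s⟩, has, rfl⟩ := mem_image.1 (mem_coe.1 hy)
      rw [mem_product] at has
      refine ⟨mem_image_of_mem _ has.1, mem_union_right _ ?_, (hmem a s a).2 fun _ => rfl⟩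
      exact mem_biUnion.2 ⟨s, has.2, mem_image_of_mem _ has.1⟩
    have hfin : {y : (Fin d → ℝ) × Set (Fin d → ℝ) |
        y.1 ∈ (range n).image pt ∧ y.2 ∈ T ∪ B₀ ∧ y.1 ∈ y.2}.Finite := by
      refine (((range n).image pt ×ˢ (T ∪ B₀)).finite_toSet).subset fun y hy => ?_
      rw [mem_coe, mem_product]
      exact ⟨hy.1, hy.2.1⟩
    refine le_trans (le_of_eq ?_) (Set.ncard_le_ncard hsub hfin)
    rw [Set.ncard_coe_finset, card_image_of_injOn, card_product, card_range]
    rintro ⟨a, s⟩ has ⟨a', s'⟩ has' heq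
    rw [mem_coe, mem_product] at has has'
    simp only [Prod.mk.injEq] at heq
    obtain rfl := hpt heq.1
    rw [hbox_inj s has.2 s' has'.2 _ _ heq.2]

end Boxes

/-! ### Choice of parameters for the lower bound -/

/-- The shapes: all coordinates but the first range over `[0, g)`, and the first one makes the sum
right. -/
theorem exists_shapes (D : ℕ) {g : ℕ} (hg : 1 ≤ g) :
    ∃ S : Finset (Fin (D + 1) → ℕ), S.card = g ^ D ∧
      ∀ s ∈ S, ∑ j, s j + 1 = D * (g - 1) + 1 := by
  classical
  let F : (Fin D → ℕ) → Fin (D + 1) → ℕ := fun v => Fin.cons (D * (g - 1) - ∑ j, v j) v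
  have hF : Function.Injective F := fun v w h => (Fin.cons_inj.1 h).2
  refine ⟨(Fintype.piFinset fun _ : Fin D => range g).image F, ?_, ?_⟩
  · rw [card_image_of_injective _ hF, Fintype.card_piFinset]
    simp
  · intro s hs
    obtain ⟨v, hv, rfl⟩ := mem_image.1 hs
    have hle : ∑ j, v j ≤ D * (g - 1) := by
      calc ∑ j, v j ≤ ∑ _j : Fin D, (g - 1) := by
            refine sum_le_sum fun j _ => ?_
            have := mem_range.1 (Fintype.mem_piFinset.1 hv j)
            omega
        _ = D * (g - 1) := by simp
    simp only [F, Fin.sum_univ_succ, Fin.cons_zero, Fin.cons_succ]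
    omega

/-- The parameters of the construction for a given large `n`: the net has prime base `b` of order
`g ^ D` and uses blocks of at most `n` points. -/
theorem exists_prime_base_of_large {D n : ℕ} (hD : 1 ≤ D) (hn : 0 < n)
    (h1 : Real.exp 1 ≤ Real.log n) (h2 : 4 + 2 * ((D : ℝ) + 1) ≤ Real.log n)
    (h3 : ((D : ℝ) + 1) ^ 2 * Real.log (Real.log n) ≤ Real.log n) :
    ∃ b g : ℕ, b.Prime ∧ D + 1 ≤ b ∧ 1 ≤ g ∧
      g ^ D * (b ^ (D * (g - 1)) * (n / b ^ (D * (g - 1) + 1) + 1)) ≤ n ∧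
      Real.log n / Real.log (Real.log n) ≤ 2 * ((D : ℝ) + 1) ^ 2 * g := by
  set x := Real.log n with hx
  have hx0 : 0 < x := (Real.exp_pos 1).trans_le h1
  have hx1 : 1 ≤ x := by
    have : (0 : ℝ) ≤ D := Nat.cast_nonneg D
    linarith
  have hy1 : 1 ≤ Real.log x := (Real.le_log_iff_exp_le hx0).2 h1
  have hy0 : 0 < Real.log x := by linarith
  set d : ℝ := (D : ℝ) + 1 with hd
  have hd1 : 1 ≤ d := by simp [hd]
  set t := x / (d ^ 2 * Real.log x) with ht
  have hden : 1 ≤ d ^ 2 * Real.log x := one_le_mul_of_one_le_of_one_le (one_le_pow₀ hd1) hy1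
  have ht1 : 1 ≤ t := (one_le_div (by linarith)).2 h3
  have htx : t ≤ x := div_le_self hx0.le hden
  obtain ⟨g, hg⟩ : ∃ g, g = ⌊t⌋₊ := ⟨_, rfl⟩
  have hg1 : 1 ≤ g := by rw [hg]; exact (Nat.one_le_floor_iff _).2 ht1
  have hgt : (g : ℝ) ≤ t := by rw [hg]; exact Nat.floor_le (by linarith)
  have htg : t < g + 1 := by rw [hg]; exact Nat.lt_floor_add_one t
  obtain ⟨b, hb, hbl, hbu⟩ := Nat.exists_prime_lt_and_le_two_mul (2 * g ^ D + (D + 1)) (by omega)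
  have hbx : (b : ℝ) ≤ x ^ (D + 1) := by
    have hxD : 1 ≤ x ^ D := one_le_pow₀ hx1
    calc (b : ℝ) ≤ 2 * (2 * (g : ℝ) ^ D + d) := by rw [hd]; exact_mod_cast hbu
      _ ≤ 2 * (2 * x ^ D + d * x ^ D) := by
          gcongr
          · linarith
          · exact le_mul_of_one_le_right (by linarith) hxD
      _ = x ^ D * (4 + 2 * d) := by ring
      _ ≤ x ^ D * x := by gcongr
      _ = x ^ (D + 1) := by ring
  have hb0 : (0 : ℝ) < b := by exact_mod_cast hb.pos
  have hlogb : Real.log b ≤ d * Real.log x := by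
    have := Real.log_le_log hb0 hbx
    rwa [Real.log_pow, Nat.cast_add_one] at this
  have hlogb0 : 0 ≤ Real.log b := Real.log_natCast_nonneg b
  have hh : ((D * (g - 1) + 1 : ℕ) : ℝ) ≤ d * g := by
    have : D * (g - 1) + 1 ≤ (D + 1) * g := by
      obtain ⟨g', rfl⟩ := Nat.exists_eq_add_of_le' hg1
      rw [Nat.add_sub_cancel]
      nlinarith
    rw [hd]
    exact_mod_cast this
  have hbn : b ^ (D * (g - 1) + 1) ≤ n := by
    have : ((b : ℝ)) ^ (D * (g - 1) + 1) ≤ n := by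
      rw [← Real.log_le_log_iff (by positivity) (by exact_mod_cast hn), Real.log_pow]
      calc ((D * (g - 1) + 1 : ℕ) : ℝ) * Real.log b ≤ d * t * (d * Real.log x) := by
            gcongr
            exact hh.trans (by gcongr)
        _ = x := by
            rw [ht]
            field_simp
    exact_mod_cast this
  refine ⟨b, g, hb, by omega, hg1, ?_, ?_⟩
  · set h := D * (g - 1) with hhdef
    have hq : 1 ≤ n / b ^ (h + 1) := Nat.div_pos hbn (Nat.pow_pos hb.pos)
    calc g ^ D * (b ^ h * (n / b ^ (h + 1) + 1))
        ≤ g ^ D * (b ^ h * (2 * (n / b ^ (h + 1)))) := by gcongr; omega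
      _ = (2 * g ^ D) * (b ^ h * (n / b ^ (h + 1))) := by ring
      _ ≤ b * (b ^ h * (n / b ^ (h + 1))) := by gcongr; omega
      _ = b ^ (h + 1) * (n / b ^ (h + 1)) := by ring
      _ ≤ n := Nat.mul_div_le _ _
  · have hxt : x / Real.log x = d ^ 2 * t := by
      rw [ht]
      field_simp
    have hg1' : (1 : ℝ) ≤ g := by exact_mod_cast hg1
    rw [hxt]
    calc d ^ 2 * t ≤ d ^ 2 * (2 * g) := by gcongr; linarith
      _ = _ := by ring

/-- For the finitely many `n` outside the reach of `exists_prime_base_of_large`, a single shape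
(`g = 1`) suffices, as the constant may be chosen large. -/
theorem exists_prime_base {D : ℕ} (hD : 1 ≤ D) :
    ∃ K : ℝ, 0 < K ∧ ∀ n : ℕ, 3 ≤ n → ∃ b g : ℕ, b.Prime ∧ D + 1 ≤ b ∧ 1 ≤ g ∧
      g ^ D * (b ^ (D * (g - 1)) * (n / b ^ (D * (g - 1) + 1) + 1)) ≤ n ∧
      Real.log n / Real.log (Real.log n) ≤ K * g := by
  have hlog : Filter.Tendsto (fun n : ℕ => Real.log n) Filter.atTop Filter.atTop :=
    Real.tendsto_log_atTop.comp tendsto_natCast_atTop_atTop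
  have hlarge : ∀ᶠ x : ℝ in Filter.atTop, Real.exp 1 ≤ x ∧ 4 + 2 * ((D : ℝ) + 1) ≤ x ∧
      ((D : ℝ) + 1) ^ 2 * Real.log x ≤ x := by
    have hc : (0 : ℝ) < 1 / ((D : ℝ) + 1) ^ 2 := by positivity
    filter_upwards [Filter.eventually_ge_atTop (Real.exp 1),
      Filter.eventually_ge_atTop (4 + 2 * ((D : ℝ) + 1)),
      Real.isLittleO_log_id_atTop.bound hc] with x h1 h2 h3
    refine ⟨h1, h2, ?_⟩
    have hx0 : 0 < x := (Real.exp_pos 1).trans_le h1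
    rw [Real.norm_eq_abs, id, Real.norm_eq_abs, abs_of_pos hx0, one_div_mul_eq_div,
      le_div_iff₀ (by positivity), mul_comm] at h3
    exact (mul_le_mul_of_nonneg_left (le_abs_self _) (by positivity)).trans h3
  obtain ⟨N, hN⟩ := Filter.eventually_atTop.1 (hlog.eventually hlarge)
  have hnonneg : ∀ n : ℕ, 0 ≤ |Real.log n / Real.log (Real.log n)| := fun n => abs_nonneg _
  refine ⟨2 * ((D : ℝ) + 1) ^ 2 + ∑ i ∈ range N, |Real.log i / Real.log (Real.log i)|,
    add_pos_of_pos_of_nonneg (by positivity) (sum_nonneg fun i _ => hnonneg i), fun n hn => ?_⟩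
  rcases le_or_gt N n with hNn | hNn
  · obtain ⟨h1, h2, h3⟩ := hN n hNn
    obtain ⟨b, g, hb, hDb, hg, hcount, hle⟩ := exists_prime_base_of_large hD (by omega) h1 h2 h3
    refine ⟨b, g, hb, hDb, hg, hcount, hle.trans ?_⟩
    gcongr
    exact le_add_of_nonneg_right (sum_nonneg fun i _ => hnonneg i)
  · obtain ⟨b, hDb, hb⟩ := Nat.exists_infinite_primes (D + 1)
    refine ⟨b, 1, hb, hDb, le_rfl, ?_, ?_⟩
    · have : n / b ≤ n / 2 := Nat.div_le_div_left hb.two_le (by norm_num)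
      simp
      omega
    · have h1 := single_le_sum (f := fun i : ℕ => |Real.log i / Real.log (Real.log i)|)
        (fun i _ => hnonneg i) (mem_range.2 hNn)
      have h2 : (0 : ℝ) < 2 * ((D : ℝ) + 1) ^ 2 := by positivity
      have h3 := le_abs_self (Real.log n / Real.log (Real.log n))
      rw [Nat.cast_one, mul_one]
      linarith

theorem exists_le_numIncidences {D : ℕ} (hD : 1 ≤ D) :
    ∃ c : ℝ, 0 < c ∧ ∀ n : ℕ, 3 ≤ n →
      ∃ (P : Finset (Fin (D + 1) → ℝ)) (B : Finset (Set (Fin (D + 1) → ℝ))),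
        P.card = n ∧ B.card = n ∧
        (∀ q ∈ B, ∃ a b : Fin (D + 1) → ℝ, (∀ i, a i < b i) ∧ q = Set.Icc a b) ∧
        (∀ k : ℕ, 2 ≤ k → IncidenceFree k P B) ∧
        c * ((n : ℝ) * (Real.log n / Real.log (Real.log n)) ^ D) ≤ (numIncidences P B : ℝ) := by
  obtain ⟨K, hK, hmain⟩ := exists_prime_base hD
  refine ⟨1 / K ^ D, by positivity, fun n hn => ?_⟩
  obtain ⟨b, g, hb, hDb, hg, hcount, hle⟩ := hmain n hn
  obtain ⟨S, hScard, hS⟩ := exists_shapes D hg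
  obtain ⟨P, B, hP, hB, hbox, hfree, hI⟩ := exists_points_boxes (n := n) hb (Nat.succ_pos D) hDb
    S hS (by rwa [hScard, Nat.add_sub_cancel])
  refine ⟨P, B, hP, hB, hbox, hfree, ?_⟩
  have hy : 0 ≤ Real.log n / Real.log (Real.log n) :=
    zero_le_one.trans (one_le_div_log_self (one_lt_log_natCast hn))
  rw [hScard] at hI
  calc 1 / K ^ D * ((n : ℝ) * (Real.log n / Real.log (Real.log n)) ^ D)
      ≤ 1 / K ^ D * ((n : ℝ) * (K * g) ^ D) := by gcongr
    _ = n * (g : ℝ) ^ D := by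
        rw [mul_pow]
        field_simp
    _ ≤ numIncidences P B := by exact_mod_cast hI

end

theorem mainTheorem1 (d : ℕ) (hd : 2 ≤ d) :
    -- upper bound for `n` points and `m` boxes
    (∀ ε : ℝ, 0 < ε → ∃ C : ℝ, 0 < C ∧
      ∀ (n m k : ℕ), 3 ≤ n →
        ∀ (P : Finset (Fin d → ℝ)) (B : Finset (Set (Fin d → ℝ))),
          P.card = n → B.card = m → (∀ q ∈ B, IsBox q) → IncidenceFree k P B →
            (numIncidences P B : ℝ) ≤
              C * ((k : ℝ) * (n : ℝ) * (Real.log n / Real.log (Real.log n)) ^ (d - 1)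
                + (k : ℝ) * (m : ℝ) * Real.log n ^ ((d : ℝ) - 2 + ε))) ∧
    -- the case `m = n`
    (∃ C : ℝ, 0 < C ∧
      ∀ (n k : ℕ), 3 ≤ n →
        ∀ (P : Finset (Fin d → ℝ)) (B : Finset (Set (Fin d → ℝ))),
          P.card = n → B.card = n → (∀ q ∈ B, IsBox q) → IncidenceFree k P B →
            (numIncidences P B : ℝ) ≤
              C * ((k : ℝ) * (n : ℝ) * (Real.log n / Real.log (Real.log n)) ^ (d - 1))) ∧
    -- the matching lower bound for `m = n`, by closed bounded boxes with non-empty interior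
    (∃ c : ℝ, 0 < c ∧
      ∀ n : ℕ, 3 ≤ n →
        ∃ (P : Finset (Fin d → ℝ)) (B : Finset (Set (Fin d → ℝ))),
          P.card = n ∧ B.card = n ∧
          (∀ q ∈ B, ∃ a b : Fin d → ℝ, (∀ i, a i < b i) ∧ q = Set.Icc a b) ∧
          (∀ k : ℕ, 2 ≤ k → IncidenceFree k P B) ∧
          c * ((n : ℝ) * (Real.log n / Real.log (Real.log n)) ^ (d - 1)) ≤
            (numIncidences P B : ℝ)) := by
  obtain ⟨d, rfl⟩ := Nat.exists_eq_add_of_le' hd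
  refine ⟨fun ε hε => ?_, ?_, ?_⟩
  · have hexp : ((d + 2 : ℕ) : ℝ) - 2 + ε = d + ε := by push_cast; ring
    rw [hexp]
    exact numIncidences_le_of_incidenceFree d hε
  · exact numIncidences_le_of_card_eq d
  · exact exists_le_numIncidences (D := d + 1) (by omega)
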